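/- Let $G$ be an SLC-group, i.e. a group such that $G/\mathcal Z(G)\cong C_2\times C_2$. Then the commutator subgroup is $G'=\{1,s\}$ for some $s\neq 1$, and the canonical involution of $G$ is $x^*=x$ if $x\in\mathcal Z(G)$ and $x^*=sx$ if $x\notin\mathcal Z(G)$. Let $R\neq 0$ be a commutative unital ring in which $2$ is a unit, and extend $*$ $R$-linearly to an involution of the group ring $RG$. Suppose that $RG$ is $*$-clean, i.e. every element of $RG$ is the sum of a unit and a projection (an idempotent $p$ with $p^*=p$). Then $G\cong Q_8\times A$ for some abelian group $A$ such that 1. $A$ has no elements of order $4$; 2. if $p$ is a prime and there is an integer $n\geq 1$ such that $p$ divides $2^n+1$, then $A$ has no elements of order $p$. Moreover, the equation $X^2+Y^2+Z^2+1=0$ has no solutions in $R$. -/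

import Mathlib

universe u v

/-- An SLC-group: the quotient by the center is a Klein four-group `C₂ × C₂`. -/
class IsSLCGroup (G : Type*) [Group G] : Prop where
  isKleinFour : IsKleinFour (G ⧸ Subgroup.center G)

namespace IsSLCGroup

open scoped commutatorElement

/-- Elements with the same class modulo the center differ by a central element. -/
theorem mem_center_of_mk_eq {G : Type*} [Group G] {a b : G} (h : (a : G ⧸ Subgroup.center G) = b) :
    ∃ z ∈ Subgroup.center G, b = a * z :=
  ⟨a⁻¹ * b, QuotientGroup.eq.1 h, by group⟩

variable {G : Type*} [Group G] [hG : IsSLCGroup G]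

/-- If `x`, `y` and `x * y` are not central, then `1`, `x`, `y`, `x * y` represent all classes
modulo the center. -/
theorem exists_central_mul {x y : G} (hx : x ∉ Subgroup.center G) (hy : y ∉ Subgroup.center G)
    (hxy : x * y ∉ Subgroup.center G) (g : G) :
    ∃ z ∈ Subgroup.center G, g = z ∨ g = x * z ∨ g = y * z ∨ g = x * y * z := by
  have := hG.isKleinFour
  have hx1 : (x : G ⧸ Subgroup.center G) ≠ 1 := fun h => hx ((QuotientGroup.eq_one_iff x).1 h)
  have hy1 : (y : G ⧸ Subgroup.center G) ≠ 1 := fun h => hy ((QuotientGroup.eq_one_iff y).1 h)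
  have hne : (x : G ⧸ Subgroup.center G) ≠ y := by
    intro h
    apply hxy
    rw [← QuotientGroup.eq_one_iff, QuotientGroup.mk_mul, h]
    exact IsKleinFour.mul_self _
  by_cases h1 : (g : G ⧸ Subgroup.center G) = 1
  · exact ⟨g, (QuotientGroup.eq_one_iff g).1 h1, Or.inl rfl⟩
  by_cases h2 : (g : G ⧸ Subgroup.center G) = x
  · obtain ⟨z, hz, h⟩ := mem_center_of_mk_eq h2.symm
    exact ⟨z, hz, Or.inr (Or.inl h)⟩
  by_cases h3 : (g : G ⧸ Subgroup.center G) = y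
  · obtain ⟨z, hz, h⟩ := mem_center_of_mk_eq h3.symm
    exact ⟨z, hz, Or.inr (Or.inr (Or.inl h))⟩
  have h4 := IsKleinFour.eq_mul_of_ne_all hx1 hy1 hne h1 h2 h3
  obtain ⟨z, hz, h⟩ := mem_center_of_mk_eq (a := x * y) (b := g) h4.symm
  exact ⟨z, hz, Or.inr (Or.inr (Or.inr h))⟩

/-- Lack of commutativity: two elements commute only if one of them or their product is central. -/
theorem mem_center_of_commute {x y : G} (h : x * y = y * x) :
    x ∈ Subgroup.center G ∨ y ∈ Subgroup.center G ∨ x * y ∈ Subgroup.center G := by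
  by_contra! hc
  obtain ⟨hx, hy, hxy⟩ := hc
  apply hx
  rw [Subgroup.mem_center_iff]
  intro g
  obtain ⟨z, hz, hg⟩ := exists_central_mul hx hy hxy g
  have hz' : ∀ a, a * z = z * a := Subgroup.mem_center_iff.1 hz
  rcases hg with rfl | rfl | rfl | rfl
  · exact (hz' x).symm
  · rw [mul_assoc, hz' x]
  · rw [mul_assoc, ← hz' x, ← mul_assoc, ← h, mul_assoc]
  · rw [mul_assoc, ← hz' x, ← mul_assoc, mul_assoc x y x, ← h, mul_assoc x (x * y) z]

variable (G) in
/-- The commutator subgroup is `{1, s}` for a nontrivial element `s`. -/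
theorem exists_commutator_eq : ∃ s : G, s ≠ 1 ∧ (commutator G : Set G) = {1, s} := by
  have := hG.isKleinFour
  have hcomm : ∀ a b : G ⧸ Subgroup.center G, a * b = b * a :=
    mul_comm_of_exponent_two IsKleinFour.exponent_two
  have hsq : ∀ g : G, g * g ∈ Subgroup.center G := fun g => by
    rw [← QuotientGroup.eq_one_iff, QuotientGroup.mk_mul]
    exact IsKleinFour.mul_self _
  have hbr : ∀ a b : G, ⁅a, b⁆ ∈ Subgroup.center G := fun a b => by
    rw [← QuotientGroup.eq_one_iff, commutatorElement_def]
    simp only [QuotientGroup.mk_mul, QuotientGroup.mk_inv]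
    rw [hcomm (a : G ⧸ Subgroup.center G) b]
    group
  obtain ⟨x, y, hxy⟩ : ∃ x y : G, x * y ≠ y * x := by
    by_contra! hc
    have htop : Subgroup.center G = ⊤ :=
      eq_top_iff.2 fun g _ => Subgroup.mem_center_iff.2 fun h => hc h g
    have h4 := IsKleinFour.card_four (G := G ⧸ Subgroup.center G)
    rw [← Subgroup.index, htop, Subgroup.index_top] at h4
    omega
  have hx : x ∉ Subgroup.center G := fun h => hxy (Subgroup.mem_center_iff.1 h y).symm
  have hy : y ∉ Subgroup.center G := fun h => hxy (Subgroup.mem_center_iff.1 h x)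
  have hxyc : x * y ∉ Subgroup.center G := fun h => hxy <| by
    have h1 := Subgroup.mem_center_iff.1 h x
    rw [mul_assoc x y x] at h1
    exact mul_left_cancel h1
  obtain ⟨s, hs⟩ : ∃ s, s = ⁅x, y⁆ := ⟨_, rfl⟩
  have hsc : ∀ a, a * s = s * a := Subgroup.mem_center_iff.1 (hs ▸ hbr x y)
  have hxys : x * y = s * (y * x) := by rw [hs, commutatorElement_def]; group
  have hss : s * s = 1 := by
    have h1 : x * x * y = s * s * (y * (x * x)) := by
      calc x * x * y = x * (s * (y * x)) := by rw [mul_assoc, hxys]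
        _ = s * (x * y * x) := by rw [← mul_assoc, hsc, mul_assoc s x, mul_assoc x y x]
        _ = s * s * (y * (x * x)) := by rw [hxys]; group
    rw [← Subgroup.mem_center_iff.1 (hsq x) y] at h1
    exact (mul_eq_right.1 h1.symm)
  have hs1 : s ≠ 1 := fun h => hxy (by rw [hxys, h, one_mul])
  -- `g` and `h` commute up to `s`
  have hsymm : ∀ g h : G, (g * h = h * g ∨ g * h = s * (h * g)) →
      (h * g = g * h ∨ h * g = s * (g * h)) := by
    rintro g h (H | H)
    · exact Or.inl H.symm
    · right
      rw [H, ← mul_assoc, hss, one_mul]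
  have hmul : ∀ g a b : G, (g * a = a * g ∨ g * a = s * (a * g)) →
      (g * b = b * g ∨ g * b = s * (b * g)) →
      (g * (a * b) = a * b * g ∨ g * (a * b) = s * (a * b * g)) := by
    have key : ∀ a c : G, a * (s * c) = s * (a * c) := fun a c => by
      rw [← mul_assoc, hsc, mul_assoc]
    rintro g a b (H | H) (K | K)
    · left; rw [← mul_assoc, H, mul_assoc, K, mul_assoc]
    · right; rw [← mul_assoc, H, mul_assoc, K, key, mul_assoc]
    · right; rw [← mul_assoc, H, mul_assoc, mul_assoc a g b, K, mul_assoc]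
    · left; rw [← mul_assoc, H, mul_assoc, mul_assoc a g b, K, key, ← mul_assoc, hss, one_mul,
        mul_assoc]
  have hall : ∀ g : G, (g * x = x * g ∨ g * x = s * (x * g)) →
      (g * y = y * g ∨ g * y = s * (y * g)) → ∀ h : G, (g * h = h * g ∨ g * h = s * (h * g)) := by
    intro g h1 h2 h
    obtain ⟨z, hz, H⟩ := exists_central_mul hx hy hxyc h
    have hz' : g * z = z * g ∨ g * z = s * (z * g) := Or.inl (Subgroup.mem_center_iff.1 hz g)
    rcases H with rfl | rfl | rfl | rfl
    · exact hz'
    · exact hmul _ _ _ h1 hz'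
    · exact hmul _ _ _ h2 hz'
    · exact hmul _ _ _ (hmul _ _ _ h1 h2) hz'
  have hX := hall x (Or.inl rfl) (Or.inr hxys)
  have hY := hall y (hsymm _ _ (Or.inr hxys)) (Or.inl rfl)
  have hgh : ∀ g h : G, (g * h = h * g ∨ g * h = s * (h * g)) := fun g =>
    hall g (hsymm _ _ (hX g)) (hsymm _ _ (hY g))
  refine ⟨s, hs1, Set.Subset.antisymm ?_ ?_⟩
  · have hsinv : s⁻¹ = s := inv_eq_of_mul_eq_one_right hss
    let S : Subgroup G :=
      { carrier := {1, s}
        one_mem' := by simp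
        mul_mem' := by
          rintro a b (rfl | rfl) (rfl | rfl) <;> simp [hss]
        inv_mem' := by
          rintro a (rfl | rfl) <;> simp [hsinv] }
    have hle : commutator G ≤ S := by
      rw [commutator_def, Subgroup.commutator_le]
      intro g _ h _
      rcases hgh g h with H | H
      · left
        exact commutatorElement_eq_one_iff_mul_comm.2 H
      · right
        change ⁅g, h⁆ = s
        rw [commutatorElement_def, H]
        group
    exact hle
  · rintro a (rfl | rfl)
    · exact (commutator G).one_mem
    · rw [hs]
      exact Subgroup.commutator_mem_commutator (Subgroup.mem_top x) (Subgroup.mem_top y)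

variable (G) in
/-- The unique nontrivial commutator `s`, that is, `G' = {1, s}`. -/
noncomputable def s : G := (exists_commutator_eq G).choose

theorem s_ne_one : s G ≠ 1 := (exists_commutator_eq G).choose_spec.1

theorem commutator_eq : (commutator G : Set G) = {1, s G} := (exists_commutator_eq G).choose_spec.2

theorem s_mul_s : s G * s G = 1 := by
  have hs : s G ∈ (commutator G : Set G) := by rw [commutator_eq]; simp
  have h : s G * s G ∈ (commutator G : Set G) := (commutator G).mul_mem hs hs
  rw [commutator_eq] at h
  rcases h with h | h
  · exact h
  · exact absurd (mul_eq_left.1 h) s_ne_one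

theorem mul_eq_or (g h : G) : g * h = h * g ∨ g * h = s G * (h * g) := by
  have hc : ⁅g, h⁆ ∈ (commutator G : Set G) :=
    Subgroup.commutator_mem_commutator (Subgroup.mem_top g) (Subgroup.mem_top h)
  rw [commutator_eq] at hc
  rcases hc with hc | hc
  · exact Or.inl (commutatorElement_eq_one_iff_mul_comm.1 hc)
  · right
    rw [Set.mem_singleton_iff, commutatorElement_def] at hc
    rw [← hc]
    group

theorem s_mem_center : s G ∈ Subgroup.center G := by
  rw [Subgroup.mem_center_iff]
  intro g
  rcases mul_eq_or g (s G) with h | h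
  · exact h
  · exfalso
    rw [← mul_assoc, s_mul_s, one_mul] at h
    exact s_ne_one (mul_eq_left.1 h)

open Classical in
/-- The canonical involution of an SLC-group: `x ↦ x` if `x` is central, `x ↦ s x` otherwise. -/
noncomputable def involution (x : G) : G :=
  if x ∈ Subgroup.center G then x else s G * x

theorem involution_of_mem {x : G} (hx : x ∈ Subgroup.center G) : involution x = x := if_pos hx

theorem involution_of_notMem {x : G} (hx : x ∉ Subgroup.center G) : involution x = s G * x :=
  if_neg hx

theorem involution_involution (x : G) : involution (involution x) = x := by
  by_cases hx : x ∈ Subgroup.center G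
  · rw [involution_of_mem hx, involution_of_mem hx]
  · have h : s G * x ∉ Subgroup.center G := fun h => hx ((Subgroup.mul_mem_cancel_left _
      s_mem_center).1 h)
    rw [involution_of_notMem hx, involution_of_notMem h, ← mul_assoc, s_mul_s, one_mul]

theorem involution_mul (x y : G) : involution (x * y) = involution y * involution x := by
  have hs : ∀ g, g * s G = s G * g := Subgroup.mem_center_iff.1 s_mem_center
  by_cases hx : x ∈ Subgroup.center G
  · have hx' : ∀ g, g * x = x * g := Subgroup.mem_center_iff.1 hx
    rw [involution_of_mem hx]
    by_cases hy : y ∈ Subgroup.center G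
    · rw [involution_of_mem hy, involution_of_mem (Subgroup.mul_mem _ hx hy), hx']
    · rw [involution_of_notMem hy, involution_of_notMem
        (fun h => hy ((Subgroup.mul_mem_cancel_left _ hx).1 h)), mul_assoc, hx']
  · rw [involution_of_notMem hx]
    by_cases hy : y ∈ Subgroup.center G
    · have hy' : ∀ g, g * y = y * g := Subgroup.mem_center_iff.1 hy
      rw [involution_of_mem hy, involution_of_notMem
        (fun h => hx ((Subgroup.mul_mem_cancel_right _ hy).1 h)), hy' x, ← mul_assoc, ← mul_assoc,
        hs y]
    · have hr : s G * y * (s G * x) = y * x := by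
        rw [← mul_assoc, mul_assoc (s G) y, hs y, ← mul_assoc, s_mul_s, one_mul]
      rw [involution_of_notMem hy, hr]
      by_cases hxy : x * y ∈ Subgroup.center G
      · rw [involution_of_mem hxy]
        have h1 := Subgroup.mem_center_iff.1 hxy x
        rw [mul_assoc x y x] at h1
        exact mul_left_cancel h1
      · rw [involution_of_notMem hxy]
        rcases mul_eq_or x y with h | h
        · rcases mem_center_of_commute h with h' | h' | h'
          exacts [absurd h' hx, absurd h' hy, absurd h' hxy]
        · rw [h, ← mul_assoc, s_mul_s, one_mul]

/-- The involution of the group ring `RG` of an SLC-group: the `R`-linear extension of the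
canonical involution of `G`. -/
noncomputable instance instStarRingMonoidAlgebra (R : Type*) [CommRing R] :
    StarRing (MonoidAlgebra R G) where
  star := MonoidAlgebra.mapDomain involution
  star_involutive a := by
    induction a using MonoidAlgebra.induction_linear with
    | zero => simp
    | add a b ha hb => simp only [MonoidAlgebra.mapDomain_add, ha, hb]
    | single g r => simp only [MonoidAlgebra.mapDomain_single, involution_involution]
  star_add a b := MonoidAlgebra.mapDomain_add involution a b
  star_mul a b := by
    induction a using MonoidAlgebra.induction_linear with
    | zero => simp
    | add a a' ha ha' => simp only [MonoidAlgebra.mapDomain_add, add_mul, mul_add, ha, ha']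
    | single g r =>
      induction b using MonoidAlgebra.induction_linear with
      | zero => simp
      | add b b' hb hb' => simp only [MonoidAlgebra.mapDomain_add, add_mul, mul_add, hb, hb']
      | single h t =>
        simp only [MonoidAlgebra.mapDomain_single, MonoidAlgebra.single_mul_single,
          involution_mul, mul_comm r t]

end IsSLCGroup

/-- A `*`-ring is `*`-clean if each element is the sum of a unit and a projection, where a
projection is a `*`-invariant idempotent. -/
def IsStarClean (S : Type*) [Ring S] [StarRing S] : Prop :=
  ∀ a : S, ∃ u p : S, IsUnit u ∧ IsStarProjection p ∧ a = u + p

/-!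
Modulo `1 + s`, the group ring `RG` becomes the quaternion algebra
`B ⊕ Bx ⊕ By ⊕ Bxy` over the commutative ring `B = R[Z(G)] / (1 + s)`, where `x`, `y` are noncommuting
elements of `G`, and `*` becomes quaternion conjugation, whose fixed points are the scalars `B` because
`2` is invertible. If a pure quaternion `β` satisfied `β² = 1` in a nonzero quotient of this algebra by
an ideal of `B`, then `α = (1 + β) / 2` would have trace `1` and norm `0`, whence
`N(α - p) = N(α) - p tr(α) + p² = 0` for every idempotent `p` of `B`: no `α - p` is a unit, and `RG` is
not `*`-clean. This is `IsSLCGroup.eq_zero_of_sq_eq_one`, the only place where cleanness is used.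
To avoid constructing the quaternion algebra and its quotients, the relations are imposed by an element
`θ` that they annihilate; the quotient is nonzero when `θ ≠ 0`.

Everything else follows by choosing `β`.

* With `β = x` for a noncentral `x`, and `x²` made equal to `1`, one finds that `s` is a power of `x²`
  (`IsSLCGroup.s_mem_zpowers_sq`). By group theory alone, `G` then contains `Q₈ = ⟨x, y⟩` with
  `x² = y² = s` (`IsSLCGroup.exists_sq_eq_s`), and `s` is not a square in `Z(G)`, as `z² = s` would give
  `(xz)² = 1`. A linear functional on `Z(G) / Z(G)²` gives a complement `A` of `⟨s⟩` in `Z(G)`, whence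
  `G ≅ Q₈ × A`. An element `z ∈ A` of order `4` is impossible, because `s` would not be a
  power of `(xz)² = s z²`.
* With `β = ux + vy + wxy` and `x² = y² = -1`, one finds that `-1` is not a sum of three squares in any
  nonzero quotient of `B` (`IsSLCGroup.eq_zero_of_sum_three_squares`), in particular not in `R`. If
  `w ∈ A` has order `p` and `p ∣ 2 ^ n + 1`, then `-1` is a sum of two squares in the nonzero quotient
  of `B` where `1 + w + ⋯ + w ^ 2 ^ n = 0`: there `-w⁻¹ = ∏ j < n, (1 + w ^ 2 ^ j)`, and `w` is a square
  since its order is odd (`IsSLCGroup.exists_sum_two_squares_add_one_mul_eq_zero`).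
-/

/-! ### Elements of SLC-groups -/

namespace IsSLCGroup

section Group

variable {G : Type u} [Group G] [IsSLCGroup G]

theorem sq_mem_center (x : G) : x ^ 2 ∈ Subgroup.center G := by
  have hG : IsKleinFour (G ⧸ Subgroup.center G) := isKleinFour
  rw [← QuotientGroup.eq_one_iff, sq, QuotientGroup.mk_mul]
  exact IsKleinFour.mul_self _

omit [IsSLCGroup G] in
theorem notMem_center_of_not_commute {x y : G} (h : ¬ Commute x y) :
    x ∉ Subgroup.center G ∧ y ∉ Subgroup.center G ∧ x * y ∉ Subgroup.center G := by
  refine ⟨fun hx => h (Subgroup.mem_center_iff.1 hx y).symm,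
    fun hy => h (Subgroup.mem_center_iff.1 hy x), fun hxy => h ?_⟩
  have h1 : x * (x * y) = x * y * x := Subgroup.mem_center_iff.1 hxy x
  rw [mul_assoc x y x] at h1
  exact mul_left_cancel h1

theorem pow_two_mul_add_one_mem_center {x : G} (j : ℕ) :
    x ^ (2 * j + 1) ∈ Subgroup.center G ↔ x ∈ Subgroup.center G := by
  rw [pow_succ, pow_mul]
  exact Subgroup.mul_mem_cancel_left _ (Subgroup.pow_mem _ (sq_mem_center x) j)

theorem exists_not_commute : ∃ x y : G, ¬ Commute x y := by
  by_contra! hc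
  have htop : Subgroup.center G = ⊤ :=
    eq_top_iff.2 fun g _ => Subgroup.mem_center_iff.2 fun h => hc h g
  have : IsKleinFour (G ⧸ Subgroup.center G) := isKleinFour
  have h4 := IsKleinFour.card_four (G := G ⧸ Subgroup.center G)
  rw [← Subgroup.index, htop, Subgroup.index_top] at h4
  omega

end Group

open MonoidAlgebra

/-! ### Self-adjoint elements and the basic obstruction to being `*`-clean -/

theorem commute_of_of_mem {G : Type u} [Group G] {R : Type v} [CommRing R] {g : G}
    (hg : g ∈ Subgroup.center G) (a : MonoidAlgebra R G) : Commute (of R G g) a :=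
  of_commute (fun h => (Subgroup.mem_center_iff.1 hg h).symm) a

section GroupRing

variable {G : Type u} [Group G] [IsSLCGroup G] {R : Type v} [CommRing R]

theorem star_single (g : G) (r : R) :
    star (single g r : MonoidAlgebra R G) = single (involution g) r :=
  mapDomain_single

theorem star_smul_eq_smul_star (r : R) (a : MonoidAlgebra R G) : star (r • a) = r • star a :=
  mapDomain_smul _ _ _

theorem star_of_mem {g : G} (hg : g ∈ Subgroup.center G) : star (of R G g) = of R G g := by
  rw [of_apply, star_single, involution_of_mem hg]

theorem star_of_notMem {g : G} (hg : g ∉ Subgroup.center G) :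
    star (of R G g) = of R G (s G) * of R G g := by
  rw [← map_mul, of_apply, star_single, involution_of_notMem hg, of_apply]

section Obstruction

variable {T : Type*} [Ring T] {f : MonoidAlgebra R G →+* T} {θ : T}

/-- Modulo `1 + s`, the element `a + a⋆` is central: it equals `2 g` or `(1 + s) g` when `a = g` is
a group element. -/
theorem map_add_star_mul_comm (hs : f (1 + of R G (s G)) * θ = 0) (a b : MonoidAlgebra R G) :
    f ((a + star a) * b) * θ = f (b * (a + star a)) * θ := by
  induction a using MonoidAlgebra.induction_linear with
  | zero => simp
  | add a a' h h' =>
    have e : a + a' + star (a + a') = (a + star a) + (a' + star a') := by rw [star_add]; abel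
    rw [e, add_mul, mul_add, f.map_add, f.map_add, add_mul (f _), add_mul (f _), h, h']
  | single g r =>
    have e : (single g r : MonoidAlgebra R G) = r • of R G g := by simp [of_apply]
    rw [e, star_smul_eq_smul_star, ← smul_add, smul_mul_assoc, mul_smul_comm]
    by_cases hg : g ∈ Subgroup.center G
    · rw [star_of_mem hg, ((commute_of_of_mem hg b).add_left (commute_of_of_mem hg b)).eq]
    · have h1 : of R G g + star (of R G g) = of R G g * (1 + of R G (s G)) := by
        rw [star_of_notMem hg, mul_add, mul_one, (commute_of_of_mem s_mem_center _).eq]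
      have hc : Commute (1 + of R G (s G)) b :=
        (Commute.one_left b).add_left (commute_of_of_mem s_mem_center b)
      have hz : ∀ c : MonoidAlgebra R G, f (r • (c * (1 + of R G (s G)))) * θ = 0 := fun c => by
        rw [← smul_mul_assoc, f.map_mul, mul_assoc, hs, mul_zero]
      rw [h1, mul_assoc, hc.eq, ← mul_assoc, ← mul_assoc, hz, hz]

/-- If `2` is invertible, self-adjoint elements are central modulo `1 + s`. -/
theorem map_mul_comm_of_isSelfAdjoint (h2 : IsUnit (2 : R))
    (hs : f (1 + of R G (s G)) * θ = 0) {p : MonoidAlgebra R G} (hp : IsSelfAdjoint p)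
    (b : MonoidAlgebra R G) : f (p * b) * θ = f (b * p) * θ := by
  obtain ⟨c, hc⟩ := h2.exists_right_inv
  have h := map_add_star_mul_comm hs (c • p) b
  rwa [star_smul_eq_smul_star, hp.star_eq, ← add_smul, ← two_mul, hc, one_smul] at h

/-- An element `α` of trace `1` and norm `0` modulo `1 + s` cannot be the sum of a unit and a
projection: if `α = u + p`, then `u u⋆` vanishes modulo `1 + s`. The element `θ`, which has to
annihilate the relations, plays the role of a nonzero element of the quotient where they hold. -/
theorem eq_zero_of_trace_norm (h2 : IsUnit (2 : R)) (hclean : IsStarClean (MonoidAlgebra R G))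
    (hs : f (1 + of R G (s G)) * θ = 0) (hθ : ∀ a, Commute (f a) θ) (α : MonoidAlgebra R G)
    (htr : f (α + star α) * θ = θ) (hnorm : f (α * star α) * θ = 0) : θ = 0 := by
  obtain ⟨U, p, hU, hp, rfl⟩ := hclean α
  obtain ⟨α, hα⟩ : ∃ α, α = U + p := ⟨_, rfl⟩
  rw [← hα] at htr hnorm
  have hUU : U * star U = α * star α - (α + star α) * p + (star α * p - p * star α) + p * p := by
    have hUα : U = α - p := by rw [hα, add_sub_cancel_right]
    rw [hUα, star_sub, hp.isSelfAdjoint.star_eq]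
    noncomm_ring
  have hcomm := map_mul_comm_of_isSelfAdjoint h2 hs hp.isSelfAdjoint (star α)
  have h0 : f (U * star U) * θ = 0 := by
    have htr' : f ((α + star α) * p) * θ = f p * θ := by
      rw [f.map_mul, mul_assoc, (hθ p).eq, ← mul_assoc, htr]
    rw [hUU, hp.isIdempotentElem.eq, f.map_add, f.map_add, f.map_sub, f.map_sub, add_mul, add_mul,
      sub_mul, sub_mul, hnorm, hcomm, htr']
    abel
  exact ((hU.mul hU.star).map f).mul_right_eq_zero.1 h0

/-- No element `β` of trace `0` can satisfy `β² = 1` modulo `1 + s`, because `(1 + β) / 2` would have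
trace `1` and norm `0`. -/
theorem eq_zero_of_sq_eq_one (h2 : IsUnit (2 : R)) (hclean : IsStarClean (MonoidAlgebra R G))
    (hs : f (1 + of R G (s G)) * θ = 0) (hθ : ∀ a, Commute (f a) θ) (β : MonoidAlgebra R G)
    (htr : f (β + star β) * θ = 0) (hsq : f (β * β) * θ = θ) : θ = 0 := by
  obtain ⟨c, hc⟩ := h2.exists_right_inv
  have hcc : ∀ a : MonoidAlgebra R G, c • a + c • a = a := fun a => by
    rw [← add_smul, ← two_mul, hc, one_smul]
  have hzero : ∀ (r : R) (a : MonoidAlgebra R G), f a * θ = 0 → f (r • a) * θ = 0 :=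
    fun r a h => by
      rw [← one_mul a, ← smul_mul_assoc, f.map_mul, mul_assoc, h, mul_zero]
  have hstar : star (c • (1 + β)) = c • (1 + star β) := by
    rw [star_smul_eq_smul_star, star_add, star_one]
  refine eq_zero_of_trace_norm h2 hclean hs hθ (c • (1 + β)) ?_ ?_
  · have e : c • (1 + β) + star (c • (1 + β)) = 1 + c • (β + star β) := by
      rw [hstar]
      nth_rewrite 3 [← hcc 1]
      simp only [smul_add]
      abel
    rw [e, f.map_add, add_mul, hzero _ _ htr, f.map_one, one_mul, add_zero]
  · rw [hstar, smul_mul_assoc, mul_smul_comm]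
    apply hzero
    apply hzero
    have e : (1 + β) * (1 + star β) = (1 + β) * (β + star β) + (1 - β * β) := by noncomm_ring
    rw [e, f.map_add, f.map_mul, f.map_sub, f.map_one, add_mul, mul_assoc, htr, mul_zero, sub_mul,
      hsq, one_mul, sub_self, add_zero]

end Obstruction

/-- If `x` is not central, then `s` is a power of `x ^ 2`: otherwise `x² = 1` in the group ring of
`G ⧸ ⟨x²⟩`, where `1 - s` survives. -/
theorem s_mem_zpowers_sq [Nontrivial R] (h2 : IsUnit (2 : R))
    (hclean : IsStarClean (MonoidAlgebra R G)) {x : G} (hx : x ∉ Subgroup.center G) :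
    s G ∈ Subgroup.zpowers (x ^ 2) := by
  by_contra hsx
  have hN : (Subgroup.zpowers (x ^ 2)).Normal := by
    refine ⟨fun n hn g => ?_⟩
    have hnc := (Subgroup.zpowers_le.2 (sq_mem_center x)) hn
    rwa [Subgroup.mem_center_iff.1 hnc g, mul_inv_cancel_right]
  let π : G →* G ⧸ Subgroup.zpowers (x ^ 2) := QuotientGroup.mk' _
  have hπs : π (s G) ≠ 1 := fun h => hsx ((QuotientGroup.eq_one_iff _).1 h)
  have hπx : π x * π x = 1 := by
    rw [← map_mul, ← sq]
    exact (QuotientGroup.eq_one_iff _).2 (Subgroup.mem_zpowers _)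
  have hπc : π (s G) ∈ Subgroup.center _ := by
    rw [Subgroup.mem_center_iff]
    intro q
    obtain ⟨g, rfl⟩ := QuotientGroup.mk'_surjective _ q
    change π g * π (s G) = π (s G) * π g
    rw [← map_mul, ← map_mul, Subgroup.mem_center_iff.1 s_mem_center g]
  let f : MonoidAlgebra R G →+* MonoidAlgebra R (G ⧸ Subgroup.zpowers (x ^ 2)) :=
    mapDomainRingHom R π
  have hf : ∀ g, f (of R G g) = of R _ (π g) := fun g => by
    simp [f, of_apply]
  have hs : f (1 + of R G (s G)) * (1 - of R _ (π (s G))) = 0 := by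
    rw [f.map_add, f.map_one, hf, add_mul, mul_sub, mul_sub, ← map_mul, ← map_mul, s_mul_s]
    simp [one_def]
  have hzero := eq_zero_of_sq_eq_one h2 hclean hs
    (fun a => (Commute.one_right _).sub_right (commute_of_of_mem hπc _).symm) (of R G x)
    (by
      have e : of R G x + star (of R G x) = of R G x * (1 + of R G (s G)) := by
        rw [star_of_notMem hx, mul_add, mul_one, (commute_of_of_mem s_mem_center _).eq]
      rw [e, f.map_mul, mul_assoc, hs, mul_zero])
    (by rw [f.map_mul, hf, ← map_mul, hπx, map_one, one_mul])
  exact hπs (of_injective (R := R) (by rw [map_one]; exact (sub_eq_zero.1 hzero).symm))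

end GroupRing

/-! ### The quaternion subgroup and its complement -/

section Structure

variable {G : Type u} [Group G] [IsSLCGroup G]

/-- A suitable odd power of a noncentral element, which has the same class modulo the center, is a
`2`-element with `s` among its powers. -/
theorem exists_odd_pow_two_pow_eq_s {x : G} (hx : s G ∈ Subgroup.zpowers (x ^ 2)) :
    ∃ j n, 1 ≤ n ∧ (x ^ (2 * j + 1)) ^ 2 ^ n = s G := by
  obtain ⟨k, hk⟩ := Subgroup.mem_zpowers_iff.1 hx
  -- the sign of the exponent is immaterial as `s⁻¹ = s`
  have hk' : (x ^ 2) ^ k.natAbs = s G := by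
    rcases Int.natAbs_eq k with h | h
    · rw [← zpow_natCast, ← h, hk]
    · rw [h, zpow_neg, zpow_natCast] at hk
      rw [← inv_inv ((x ^ 2) ^ k.natAbs), hk, inv_eq_of_mul_eq_one_left s_mul_s]
  have hk0 : k.natAbs ≠ 0 := by
    intro h
    rw [h, pow_zero] at hk'
    exact s_ne_one hk'.symm
  obtain ⟨e, m, hm, hkm⟩ := Nat.exists_eq_two_pow_mul_odd hk0
  obtain ⟨j, rfl⟩ := hm
  refine ⟨j, e + 1, by omega, ?_⟩
  rw [← hk', hkm, ← pow_mul, ← pow_mul]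
  congr 1
  ring

/-- If `s` is a power of `x ^ 2` for each noncentral `x`, then `G` contains a copy of the
quaternion group of order `8`. It is generated by noncommuting elements `x`, `y` with `x ^ 2 ^ n =
y ^ 2 ^ n = s` for the least possible `n`, for which `n = 1` follows from
`(x * y) ^ 2 = s * x ^ 2 * y ^ 2`. -/
theorem exists_sq_eq_s (hpow : ∀ x : G, x ∉ Subgroup.center G → s G ∈ Subgroup.zpowers (x ^ 2)) :
    ∃ x y : G, ¬ Commute x y ∧ x ^ 2 = s G ∧ y ^ 2 = s G := by
  classical
  have hcen : ∀ {z : G}, z ∈ Subgroup.center G → ∀ g, Commute g z :=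
    fun hz g => Subgroup.mem_center_iff.1 hz g
  have hex : ∃ n, ∃ y : G, y ∉ Subgroup.center G ∧ 1 ≤ n ∧ y ^ 2 ^ n = s G := by
    obtain ⟨x, y, hxy⟩ := exists_not_commute (G := G)
    have hx : x ∉ Subgroup.center G := fun h => hxy (hcen h y).symm
    obtain ⟨j, n, hn, h⟩ := exists_odd_pow_two_pow_eq_s (hpow x hx)
    exact ⟨n, _, fun hc => hx ((pow_two_mul_add_one_mem_center j).1 hc), hn, h⟩
  obtain ⟨n, hn⟩ : ∃ n, n = Nat.find hex := ⟨_, rfl⟩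
  obtain ⟨y, hy, hn1, hyn⟩ := Nat.find_spec hex
  rw [← hn] at hyn hn1
  have hmin : ∀ g : G, g ∉ Subgroup.center G → g ^ 2 ^ n ≠ 1 := by
    intro g hg hgn
    obtain ⟨j, e, he, h⟩ := exists_odd_pow_two_pow_eq_s (hpow g hg)
    have hne : n ≤ e := hn ▸ Nat.find_min' hex
      ⟨_, fun hc => hg ((pow_two_mul_add_one_mem_center j).1 hc), he, h⟩
    obtain ⟨d, rfl⟩ := Nat.exists_eq_add_of_le hne
    rw [← pow_mul, mul_comm, pow_add, pow_mul, pow_mul, hgn, one_pow, one_pow] at h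
    exact s_ne_one h.symm
  obtain ⟨x₀, hx₀⟩ : ∃ x, ¬ Commute x y := by
    by_contra! hc
    exact hy (Subgroup.mem_center_iff.2 hc)
  have hx₀c : x₀ ∉ Subgroup.center G := fun h => hx₀ (hcen h y).symm
  obtain ⟨j, r, hr, hxr⟩ := exists_odd_pow_two_pow_eq_s (hpow x₀ hx₀c)
  obtain ⟨x, hx⟩ : ∃ x, x = x₀ ^ (2 * j + 1) := ⟨_, rfl⟩
  rw [← hx] at hxr
  have hxc : x ∉ Subgroup.center G := fun h =>
    hx₀c ((pow_two_mul_add_one_mem_center j).1 (hx ▸ h))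
  have hxy : ¬ Commute x y := by
    intro h
    have h1 : Commute ((x₀ ^ 2) ^ j) y :=
      (hcen (Subgroup.pow_mem _ (sq_mem_center x₀) j) y).symm
    apply hx₀
    rw [hx, pow_succ, pow_mul] at h
    have h3 := h1.inv_left.mul_left h
    rwa [inv_mul_cancel_left] at h3
  have hnr : n ≤ r := hn ▸ Nat.find_min' hex ⟨x, hxc, hr, hxr⟩
  obtain ⟨d, rfl⟩ := Nat.exists_eq_add_of_le hnr
  rcases Nat.eq_zero_or_pos d with rfl | hd
  · rw [add_zero] at hxr
    obtain ⟨m, rfl⟩ := Nat.exists_eq_add_of_le' hn1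
    rcases Nat.eq_zero_or_pos m with rfl | hm
    · exact ⟨x, y, hxy, by simpa using hxr, by simpa using hyn⟩
    · exfalso
      have hsq : (x * y) ^ 2 = s G * (x ^ 2 * y ^ 2) := by
        have h1 : y * x = s G * (x * y) := (mul_eq_or y x).resolve_left fun h => hxy h.symm
        calc (x * y) ^ 2 = x * (y * x) * y := by simp only [sq, mul_assoc]
          _ = x * s G * (x * y * y) := by rw [h1]; simp only [mul_assoc]
          _ = s G * (x ^ 2 * y ^ 2) := by rw [(hcen s_mem_center x).eq]; simp only [sq, mul_assoc]
      apply hmin _ (notMem_center_of_not_commute hxy).2.2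
      have hsm : s G ^ 2 ^ m = 1 := by
        obtain ⟨m, rfl⟩ := Nat.exists_eq_add_of_le' hm
        rw [pow_succ', pow_mul, sq, s_mul_s, one_pow]
      rw [pow_succ', pow_mul, hsq, (hcen s_mem_center _).symm.mul_pow,
        (hcen (sq_mem_center y) _).mul_pow, hsm, one_mul, ← pow_mul, ← pow_mul, ← pow_succ', hxr,
        hyn, s_mul_s]
  · exfalso
    obtain ⟨d, rfl⟩ := Nat.exists_eq_add_of_le' hd
    -- `z` is a central element with `z ^ 2 ^ n = s`
    obtain ⟨z, hz⟩ : ∃ z, z = x ^ 2 ^ (d + 1) := ⟨_, rfl⟩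
    have hzc : z ∈ Subgroup.center G := by
      rw [hz, pow_succ', pow_mul]
      exact Subgroup.pow_mem _ (sq_mem_center x) _
    apply hmin (y * z) fun h => hy ((Subgroup.mul_mem_cancel_right _ hzc).1 h)
    rw [(hcen hzc y).mul_pow, hyn, hz, ← pow_mul, ← pow_add, add_comm (d + 1) n, hxr, s_mul_s]

/-- An element `t` that is not a square is nonzero in the vector space `Z / Z²` over `𝔽₂`, so a linear
functional takes the value `1` at `t`. Its kernel is a subgroup `A` with `Z = A ∪ t⁻¹ A`. -/
theorem exists_subgroup_notMem_of_not_isSquare {Z : Type*} [CommGroup Z] {t : Z}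
    (ht : ¬ IsSquare t) : ∃ A : Subgroup Z, t ∉ A ∧ ∀ z, z ∈ A ∨ t * z ∈ A := by
  let Q := Z ⧸ (powMonoidHom 2 : Z →* Z).range
  let _ : Module (ZMod 2) (Additive Q) := AddCommGroup.zmodModule (by
    intro x
    obtain ⟨z, hz⟩ := QuotientGroup.mk_surjective x.toMul
    change Additive.ofMul (x.toMul ^ 2) = 0
    rw [← hz, ← QuotientGroup.mk_pow]
    exact congrArg Additive.ofMul ((QuotientGroup.eq_one_iff _).2 ⟨z, rfl⟩))
  have htQ : Additive.ofMul ((t : Q)) ≠ 0 := by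
    intro h
    obtain ⟨z, hz⟩ := (QuotientGroup.eq_one_iff t).1 (Additive.ofMul.injective h)
    exact ht ⟨z, by rw [← hz, powMonoidHom_apply, sq]⟩
  obtain ⟨φ, hφ⟩ := Module.Projective.exists_dual_eq_one (ZMod 2) htQ
  let A : Subgroup Z :=
    { carrier := {z | φ (Additive.ofMul (z : Q)) = 0}
      one_mem' := map_zero φ
      mul_mem' := fun {a b} ha hb => by
        change φ (Additive.ofMul (a : Q) + Additive.ofMul (b : Q)) = 0
        rw [map_add, show φ _ = 0 from ha, show φ _ = 0 from hb, add_zero]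
      inv_mem' := fun {a} ha => by
        change φ (-Additive.ofMul (a : Q)) = 0
        rw [map_neg, show φ _ = 0 from ha, neg_zero] }
  have hA : ∀ z, z ∈ A ↔ φ (Additive.ofMul (z : Q)) = 0 := fun z => Iff.rfl
  refine ⟨A, ?_, fun z => ?_⟩
  · rw [hA, hφ]
    exact one_ne_zero
  · rw [hA, hA]
    have : φ (Additive.ofMul ((t * z : Z) : Q)) = 1 + φ (Additive.ofMul (z : Q)) := by
      rw [← hφ, ← map_add]
      rfl
    rw [this]
    generalize φ (Additive.ofMul (z : Q)) = c
    revert c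
    decide

end Structure

end IsSLCGroup

/-- The homomorphism from the quaternion group of order `8` given by elements `x`, `y` which satisfy
its defining relations. -/
def QuaternionGroup.liftTwo {G : Type*} [Group G] {x y : G} (hx : x ^ 4 = 1) (hyx : y ^ 2 = x ^ 2)
    (hxy : x * y = y * x⁻¹) : QuaternionGroup 2 →* G :=
  have hadd : ∀ i j : ZMod (2 * 2), x ^ (i + j).val = x ^ i.val * x ^ j.val := fun i j => by
    rw [ZMod.val_add, ← pow_add]
    exact (pow_eq_pow_mod _ hx).symm
  have hsub : ∀ i j : ZMod (2 * 2), x ^ (j - i).val = (x ^ i.val)⁻¹ * x ^ j.val := fun i j => by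
    rw [eq_inv_mul_iff_mul_eq, ← hadd, add_sub_cancel]
  have hconj : ∀ n : ℕ, x ^ n * y = y * (x ^ n)⁻¹ := fun n => by
    have h : SemiconjBy y x⁻¹ x := hxy.symm
    rw [← inv_pow, (h.pow_right n).eq]
  { toFun := fun q => match q with
      | .a i => x ^ i.val
      | .xa i => y * x ^ i.val
    map_one' := by
      change x ^ (0 : ZMod (2 * 2)).val = 1
      simp
    map_mul' := by
      rintro (i | i) (j | j)
      · exact hadd i j
      · change y * x ^ (j - i).val = x ^ i.val * (y * x ^ j.val)
        rw [hsub, ← mul_assoc, ← mul_assoc, hconj]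
      · change y * x ^ (i + j).val = y * x ^ i.val * x ^ j.val
        rw [hadd, mul_assoc]
      · change x ^ ((2 : ℕ) + j - i : ZMod (2 * 2)).val = y * x ^ i.val * (y * x ^ j.val)
        rw [add_sub_assoc, hadd, hsub, mul_assoc y, ← mul_assoc (x ^ i.val), hconj, mul_assoc y,
          ← mul_assoc y y, ← sq y, hyx]
        rfl }

namespace IsSLCGroup

open MonoidAlgebra
open scoped IsMulCommutative

section Structure

variable {G : Type u} [Group G] [IsSLCGroup G]

/-- Noncommuting elements `x`, `y` with `x ^ 2 = y ^ 2 = s` and a subgroup `A` of the center, of which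
`A` and `s A` are the only cosets, decompose `G` as the product of `Q₈ = ⟨x, y⟩` and `A`. -/
theorem nonempty_mulEquiv_quaternionGroup_prod {x y : G} (hxy : ¬ Commute x y) (hx : x ^ 2 = s G)
    (hy : y ^ 2 = s G) {A : Subgroup (Subgroup.center G)}
    (hsA : (⟨s G, s_mem_center⟩ : Subgroup.center G) ∉ A)
    (hA : ∀ z, z ∈ A ∨ ⟨s G, s_mem_center⟩ * z ∈ A) :
    Nonempty (G ≃* QuaternionGroup 2 × A) := by
  have hval : ∀ i : ZMod (2 * 2), i = 0 ∨ i = 1 ∨ i = 2 ∨ i = 3 := by decide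
  have hcen : ∀ {z : G}, z ∈ Subgroup.center G → ∀ g, Commute g z :=
    fun hz g => Subgroup.mem_center_iff.1 hz g
  have hx4 : x ^ 4 = 1 := by rw [show 4 = 2 * 2 from rfl, pow_mul, hx, sq, s_mul_s]
  have hxinv : x⁻¹ = x * s G := by
    rw [← hx, inv_eq_iff_mul_eq_one, ← hx4]
    group
  have hrel : x * y = y * x⁻¹ := by
    rw [(mul_eq_or x y).resolve_left hxy, hxinv, ← mul_assoc y, (hcen s_mem_center (y * x)).eq]
  let φ := QuaternionGroup.liftTwo hx4 (hy.trans hx.symm) hrel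
  have hφa : ∀ i, φ (.a i) = x ^ i.val := fun i => rfl
  have hφxa : ∀ i, φ (.xa i) = y * x ^ i.val := fun i => rfl
  let ι : A →* G := (Subgroup.center G).subtype.comp A.subtype
  let Ψ : QuaternionGroup 2 × A →* G := φ.noncommCoprod ι fun q a => hcen a.1.2 _
  have hΨ : ∀ q a, Ψ (q, a) = φ q * ι a := fun q a => rfl
  obtain ⟨hxc, hyc, hxyc⟩ := notMem_center_of_not_commute hxy
  refine ⟨(MulEquiv.ofBijective Ψ ⟨?_, ?_⟩).symm⟩
  · rw [injective_iff_map_eq_one]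
    rintro ⟨q, a⟩ h
    rw [hΨ] at h
    have hq : φ q ∈ Subgroup.center G := by
      rw [eq_inv_of_mul_eq_one_left h]
      exact Subgroup.inv_mem _ a.1.2
    rcases q with i | i
    · rcases hval i with rfl | rfl | rfl | rfl
      · rw [hφa, show (0 : ZMod (2 * 2)).val = 0 from rfl, pow_zero, one_mul] at h
        have ha : a = 1 := Subtype.ext (Subtype.ext h)
        rw [ha]
        rfl
      · rw [hφa, show (1 : ZMod (2 * 2)).val = 1 from rfl, pow_one] at hq
        exact absurd hq hxc
      · rw [hφa, show (2 : ZMod (2 * 2)).val = 2 from rfl, hx] at h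
        have ha : (⟨s G, s_mem_center⟩ : Subgroup.center G) = a⁻¹ :=
          Subtype.ext (eq_inv_of_mul_eq_one_left h)
        exact absurd (ha ▸ A.inv_mem a.2) hsA
      · rw [hφa, show (3 : ZMod (2 * 2)).val = 2 * 1 + 1 from rfl,
          pow_two_mul_add_one_mem_center] at hq
        exact absurd hq hxc
    · rw [hφxa] at hq
      have h1 : Commute x (y * x ^ i.val * (x ^ i.val)⁻¹) :=
        (hcen hq x).mul_right (((Commute.refl x).pow_right _).inv_right)
      rw [mul_inv_cancel_right] at h1
      exact absurd h1 hxy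
  · rw [← MonoidHom.range_eq_top, eq_top_iff]
    intro g _
    have hxr : x ∈ Ψ.range := ⟨(.a 1, 1), by
      rw [hΨ, hφa, map_one, mul_one, show (1 : ZMod (2 * 2)).val = 1 from rfl, pow_one]⟩
    have hyr : y ∈ Ψ.range := ⟨(.xa 0, 1), by
      rw [hΨ, hφxa, map_one, mul_one, show (0 : ZMod (2 * 2)).val = 0 from rfl, pow_zero, mul_one]⟩
    have hsr : s G ∈ Ψ.range := hx ▸ Subgroup.pow_mem _ hxr 2
    have hAr : ∀ z : Subgroup.center G, z ∈ A → (z : G) ∈ Ψ.range := fun z hz =>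
      ⟨(1, ⟨z, hz⟩), by rw [hΨ, map_one, one_mul]; rfl⟩
    have hcr : ∀ z ∈ Subgroup.center G, z ∈ Ψ.range := fun z hz => by
      rcases hA ⟨z, hz⟩ with h | h
      · exact hAr _ h
      · exact (Subgroup.mul_mem_cancel_left _ hsr).1 (hAr _ h)
    obtain ⟨z, hz, rfl | rfl | rfl | rfl⟩ := exists_central_mul hxc hyc hxyc g
    · exact hcr _ hz
    · exact Subgroup.mul_mem _ hxr (hcr _ hz)
    · exact Subgroup.mul_mem _ hyr (hcr _ hz)
    · exact Subgroup.mul_mem _ (Subgroup.mul_mem _ hxr hyr) (hcr _ hz)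

end Structure

/-! ### Sums of three squares in the group ring of the center -/

/-- In a quaternion algebra the square of a pure quaternion is a scalar. Here `σ` stands for `-1`,
and `X ^ 2 = Y ^ 2 = σ`. -/
theorem pure_quaternion_mul_self {k S : Type*} [CommRing k] [Ring S] [Algebra k S] {σ : k} {X Y : S}
    (hσ : σ * σ = 1) (hX : X * X = σ • 1) (hY : Y * Y = σ • 1) (hYX : Y * X = σ • (X * Y))
    (u v w : k) :
    (u • X + v • Y + w • (X * Y)) * (u • X + v • Y + w • (X * Y)) =
      (σ * (u ^ 2 + v ^ 2 + w ^ 2)) • 1 +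
        (1 + σ) • ((u * v) • (X * Y) + (u * w) • Y + (v * w) • X) := by
  have h1 : X * (X * Y) = σ • Y := by rw [← mul_assoc, hX, smul_mul_assoc, one_mul]
  have h2 : X * Y * X = Y := by
    rw [mul_assoc, hYX, mul_smul_comm, h1, smul_smul, hσ, one_smul]
  have h3 : Y * (X * Y) = X := by
    rw [← mul_assoc, hYX, smul_mul_assoc, mul_assoc, hY, mul_smul_comm, mul_one, smul_smul, hσ,
      one_smul]
  have h4 : X * Y * Y = σ • X := by rw [mul_assoc, hY, mul_smul_comm, mul_one]
  have h5 : X * Y * (X * Y) = σ • 1 := by rw [← mul_assoc, h2, hY]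
  simp only [add_mul, mul_add, smul_mul_smul_comm, hX, hY, hYX, h1, h2, h3, h4, h5]
  module

section Center

variable {G : Type u} [Group G] {R : Type v} [CommRing R]

variable (G R) in
/-- The inclusion of the group ring of the center. -/
noncomputable def centerHom : MonoidAlgebra R (Subgroup.center G) →+* MonoidAlgebra R G :=
  mapDomainRingHom R (Subgroup.center G).subtype

theorem centerHom_of (z : Subgroup.center G) : centerHom G R (of R _ z) = of R G z := by
  simp [centerHom, of_apply]

theorem centerHom_commute (a : MonoidAlgebra R (Subgroup.center G)) (b : MonoidAlgebra R G) :
    Commute (centerHom G R a) b := by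
  induction a using MonoidAlgebra.induction_linear with
  | zero => simp
  | add a a' h h' => rw [RingHom.map_add]; exact h.add_left h'
  | single z r =>
    have e : (single z r : MonoidAlgebra R (Subgroup.center G)) =
        algebraMap R _ r * of R _ z := by
      simp [of_apply]
    have e' : centerHom G R (algebraMap R _ r) = algebraMap R _ r := by
      simp [centerHom, coe_algebraMap]
    rw [e, RingHom.map_mul, e', centerHom_of]
    exact (show Commute _ _ from Algebra.commutes r b).mul_left (commute_of_of_mem z.2 b)

theorem centerHom_injective : Function.Injective (centerHom G R) :=
  mapDomain_injective Subtype.val_injective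

theorem star_centerHom [IsSLCGroup G] (a : MonoidAlgebra R (Subgroup.center G)) :
    star (centerHom G R a) = centerHom G R a := by
  induction a using MonoidAlgebra.induction_linear with
  | zero => simp
  | add a a' h h' => rw [RingHom.map_add, star_add, h, h']
  | single z r =>
    have e : centerHom G R (single z r) = single (z : G) r := by simp [centerHom]
    rw [e, star_single, involution_of_mem z.2]

variable [IsSLCGroup G]

/-- If `G` contains `Q₈` and `RG` is `*`-clean, then `-1` is not a sum of three squares modulo
`1 + s` among central self-adjoint elements. These form the image of `k` (in the applications, the
group ring of the center), and `θ` stands for `1` in the quotient. -/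
theorem eq_zero_of_sum_three_squares (h2 : IsUnit (2 : R))
    (hclean : IsStarClean (MonoidAlgebra R G)) {x y : G} (hxy : ¬ Commute x y) (hx : x ^ 2 = s G)
    (hy : y ^ 2 = s G) {k : Type*} [CommRing k] (ι : k →+* MonoidAlgebra R G)
    (hcomm : ∀ a b, Commute (ι a) b) (hfix : ∀ a, star (ι a) = ι a) {σ θ u v w : k}
    (hσ : σ * σ = 1) (hσs : ι σ = of R G (s G)) (hs : (1 + σ) * θ = 0)
    (h : (u ^ 2 + v ^ 2 + w ^ 2 + 1) * θ = 0) : ι θ = 0 := by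
  let _ : Algebra k (MonoidAlgebra R G) := ι.toAlgebra' fun a b => hcomm a b
  have hsmul : ∀ (a : k) (b : MonoidAlgebra R G), a • b = ι a * b := fun a b => rfl
  obtain ⟨hxc, hyc, hxyc⟩ := notMem_center_of_not_commute hxy
  have hX : of R G x * of R G x = σ • 1 := by
    rw [hsmul, mul_one, hσs, ← hx, sq, map_mul]
  have hY : of R G y * of R G y = σ • 1 := by
    rw [hsmul, mul_one, hσs, ← hy, sq, map_mul]
  have hYX : of R G y * of R G x = σ • (of R G x * of R G y) := by
    rw [hsmul, hσs, ← map_mul, (mul_eq_or y x).resolve_left fun h => hxy h.symm, map_mul, map_mul]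
  have hstar : ∀ (a : k) {g : G}, g ∉ Subgroup.center G →
      star (a • of R G g) = σ • a • of R G g := fun a g hg => by
    rw [hsmul, star_mul, hfix, star_of_notMem hg, ← hσs, ← (hcomm a _).eq, hsmul,
      ← mul_assoc, (hcomm a (ι σ)).eq, mul_assoc]
  have hs' : ∀ b : MonoidAlgebra R G, (1 + σ) • b * ι θ = 0 := fun b => by
    rw [hsmul, mul_assoc, ← (hcomm θ b).eq, ← mul_assoc, ← ι.map_mul, hs, ι.map_zero, zero_mul]
  refine eq_zero_of_sq_eq_one (f := RingHom.id (MonoidAlgebra R G)) (θ := ι θ) h2 hclean ?_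
    (fun a => (hcomm θ a).symm)
    (u • of R G x + v • of R G y + w • (of R G x * of R G y)) ?_ ?_
  · rw [RingHom.id_apply, ← hσs, ← ι.map_one, ← ι.map_add, ← ι.map_mul, hs, ι.map_zero]
  · rw [RingHom.id_apply, star_add, star_add, hstar _ hxc, hstar _ hyc, ← map_mul, hstar _ hxyc]
    rw [← smul_add, ← smul_add]
    have e : ∀ b : MonoidAlgebra R G, b + σ • b = (1 + σ) • b := fun b => by
      rw [add_smul, one_smul]
    rw [e, hs']
  · rw [RingHom.id_apply, pure_quaternion_mul_self hσ hX hY hYX, add_mul, hs', add_zero, hsmul,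
      mul_one, ← ι.map_mul]
    congr 1
    linear_combination σ * h - hs

end Center

/-! ### Sums of squares in cyclotomic quotients -/

/-- The sum is the product of the factors `1 + (η ^ 2 ^ j) ^ 2`, `j < n`. -/
theorem exists_sum_pow_eq_sum_two_squares {k : Type*} [CommRing k] (η : k) (n : ℕ) :
    ∃ u v : k, ∑ i ∈ Finset.range (2 ^ n), (η ^ 2) ^ i = u ^ 2 + v ^ 2 := by
  induction n with
  | zero => exact ⟨1, 0, by simp⟩
  | succ n ih =>
    obtain ⟨u, v, h⟩ := ih
    refine ⟨u - v * η ^ 2 ^ n, v + u * η ^ 2 ^ n, ?_⟩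
    have e : ∑ i ∈ Finset.range (2 ^ (n + 1)), (η ^ 2) ^ i =
        (1 + (η ^ 2) ^ 2 ^ n) * ∑ i ∈ Finset.range (2 ^ n), (η ^ 2) ^ i := by
      rw [pow_succ, mul_two, Finset.sum_range_add, add_mul, one_mul, Finset.mul_sum]
      simp only [pow_add]
    rw [e, h, ← pow_mul, mul_comm 2, pow_mul]
    ring

/-- If `ζ = η ^ 2` satisfies `ζ ^ (2 ^ n + 1) = 1`, then `-1` is a sum of two squares in the quotient
where `1 + ζ + ⋯ + ζ ^ 2 ^ n = 0`. Indeed the sum of the first `2 ^ n` terms is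
`∏ j < n, (1 + (η ^ 2 ^ j) ^ 2)`, and it equals `-ζ⁻¹`. -/
theorem exists_sum_two_squares_add_one_mul_eq_zero {k : Type*} [CommRing k] {η θ : k} {n : ℕ}
    (hη : (η ^ 2) ^ (2 ^ n + 1) = 1)
    (hθ : (∑ i ∈ Finset.range (2 ^ n + 1), (η ^ 2) ^ i) * θ = 0) :
    ∃ u v : k, (u ^ 2 + v ^ 2 + 1) * θ = 0 := by
  obtain ⟨u, v, h⟩ := exists_sum_pow_eq_sum_two_squares η n
  refine ⟨η * u, η * v, ?_⟩
  rw [Finset.sum_range_succ, h] at hθ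
  rw [pow_succ] at hη
  linear_combination η ^ 2 * hθ - θ * hη

end IsSLCGroup

/-! ### The structure of `G` and the equation over `R` -/

open MonoidAlgebra IsSLCGroup IsMulCommutative in
theorem theoremA {G : Type u} [Group G] [IsSLCGroup G]
    {R : Type v} [CommRing R] [Nontrivial R] (h2 : IsUnit (2 : R))
    (hclean : IsStarClean (MonoidAlgebra R G)) :
    (∃ (A : Type u) (_ : CommGroup A),
      Nonempty (G ≃* QuaternionGroup 2 × A) ∧
      (∀ a : A, orderOf a ≠ 4) ∧
      (∀ p : ℕ, p.Prime → (∃ n : ℕ, 1 ≤ n ∧ p ∣ 2 ^ n + 1) → ∀ a : A, orderOf a ≠ p)) ∧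
    ¬ ∃ X Y Z : R, X ^ 2 + Y ^ 2 + Z ^ 2 + 1 = 0 := by
  have hpow : ∀ x : G, x ∉ Subgroup.center G → s G ∈ Subgroup.zpowers (x ^ 2) :=
    fun x hx => s_mem_zpowers_sq h2 hclean hx
  obtain ⟨x, y, hxy, hx, hy⟩ := exists_sq_eq_s hpow
  have hcen : ∀ {z : G}, z ∈ Subgroup.center G → ∀ g, Commute g z :=
    fun hz g => Subgroup.mem_center_iff.1 hz g
  have hxc := (notMem_center_of_not_commute hxy).1
  obtain ⟨t, ht⟩ : ∃ t : Subgroup.center G, t = ⟨s G, s_mem_center⟩ := ⟨_, rfl⟩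
  have hts : (t : G) = s G := by rw [ht]
  have htt : t * t = 1 := Subtype.ext (by rw [Subgroup.coe_mul, hts, s_mul_s]; rfl)
  have ht1 : t ≠ 1 := fun h => s_ne_one (G := G) (by rw [← hts, h]; rfl)
  -- the squares `s * z ^ 2` of the elements of `x Z(G)` have `s` among their powers
  have hz : ∀ z : Subgroup.center G, t ∈ Subgroup.zpowers (t * z ^ 2) := by
    intro z
    have h := hpow (x * z) fun h => hxc ((Subgroup.mul_mem_cancel_right _ z.2).1 h)
    rw [(hcen z.2 x).mul_pow, hx] at h
    obtain ⟨k, hk⟩ := Subgroup.mem_zpowers_iff.1 h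
    refine Subgroup.mem_zpowers_iff.2 ⟨k, Subtype.ext ?_⟩
    rw [hts, ← hk, ← hts]
    rfl
  have htsq : ¬ IsSquare t := by
    rintro ⟨z, h⟩
    have := hz z
    rw [sq, ← h, htt, Subgroup.zpowers_one_eq_bot, Subgroup.mem_bot] at this
    exact ht1 this
  obtain ⟨A, htA, hA⟩ := exists_subgroup_notMem_of_not_isSquare htsq
  have hthree : ∀ θ : MonoidAlgebra R (Subgroup.center G), (1 + of R _ t) * θ = 0 →
      (∃ u v w : MonoidAlgebra R (Subgroup.center G), (u ^ 2 + v ^ 2 + w ^ 2 + 1) * θ = 0) →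
      θ = 0 := by
    rintro θ hθ ⟨u, v, w, h⟩
    apply centerHom_injective
    rw [RingHom.map_zero]
    exact eq_zero_of_sum_three_squares h2 hclean hxy hx hy (centerHom G R) centerHom_commute
      star_centerHom (by rw [← map_mul, htt, map_one]) (by rw [centerHom_of, hts]) hθ h
  have htθ : (1 + of R _ t) * (1 - of R _ t) = 0 := by
    have h : of R _ t * of R _ t = 1 := by rw [← map_mul, htt, map_one]
    linear_combination -h
  refine ⟨⟨A, inferInstance, ?_, ?_, ?_⟩, ?_⟩
  · subst ht
    exact nonempty_mulEquiv_quaternionGroup_prod hxy hx hy htA hA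
  · intro a ha
    have ha' : orderOf (a : Subgroup.center G) = 4 := by rw [Subgroup.orderOf_coe, ha]
    obtain ⟨k, hk⟩ := Subgroup.mem_zpowers_iff.1 (hz a)
    have ha4 : (t * (a : Subgroup.center G) ^ 2) ^ (2 : ℤ) = 1 := by
      rw [zpow_ofNat, mul_pow, ← pow_mul, sq t, htt, one_mul,
        show 2 * 2 = orderOf (a : Subgroup.center G) from ha'.symm, pow_orderOf_eq_one]
    rcases Int.even_or_odd' k with ⟨j, rfl | rfl⟩
    · rw [zpow_mul, ha4, one_zpow] at hk
      exact ht1 hk.symm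
    · rw [zpow_add_one, zpow_mul, ha4, one_zpow, one_mul] at hk
      have := orderOf_dvd_of_pow_eq_one (mul_eq_left.1 hk)
      rw [ha'] at this
      omega
  · rintro p hp ⟨n, hn, hpn⟩ a ha
    obtain ⟨w, hw⟩ : ∃ w : Subgroup.center G, w = a := ⟨_, rfl⟩
    have hw1 : w ^ (2 ^ n + 1) = 1 := by
      rw [← orderOf_dvd_iff_pow_eq_one, hw, Subgroup.orderOf_coe, ha]
      exact hpn
    have hwne : w ≠ 1 := by
      rintro rfl
      rw [← Subgroup.orderOf_coe, ← hw, orderOf_one] at ha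
      exact hp.ne_one ha.symm
    have htw : t * w ≠ 1 := fun h => htA (by
      rw [eq_inv_of_mul_eq_one_left h, hw]
      exact A.inv_mem a.2)
    -- `w` has odd order, hence is a square
    have hη : (of R _ (w ^ (2 ^ (n - 1) + 1))) ^ 2 = of R _ w := by
      obtain ⟨m, rfl⟩ := Nat.exists_eq_add_of_le' hn
      rw [← map_pow, ← pow_mul, Nat.add_sub_cancel, add_mul, ← pow_succ, one_mul,
        show 2 ^ (m + 1) + 2 = 2 ^ (m + 1) + 1 + 1 from rfl, pow_succ, hw1, one_mul]
    have hgeom : (∑ i ∈ Finset.range (2 ^ n + 1), of R _ w ^ i) * (1 - of R _ w) = 0 := by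
      rw [geom_sum_mul_neg, ← map_pow, hw1, map_one, sub_self]
    obtain ⟨u, v, huv⟩ := exists_sum_two_squares_add_one_mul_eq_zero
      (η := of R _ (w ^ (2 ^ (n - 1) + 1))) (θ := (1 - of R _ w) * (1 - of R _ t)) (n := n)
      (by rw [hη, ← map_pow, hw1, map_one]) (by rw [hη, ← mul_assoc, hgeom, zero_mul])
    have h0 := hthree ((1 - of R _ w) * (1 - of R _ t)) (by rw [mul_left_comm, htθ, mul_zero])
      ⟨u, v, 0, by rw [zero_pow two_ne_zero, add_zero, huv]⟩
    -- the coefficient at `1` of `(1 - w) * (1 - s)` is `1`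
    have h1 : of R _ 1 + of R _ (t * w) - of R _ t - of R _ w = 0 := by
      rw [map_mul, map_one]
      linear_combination h0
    have h2 := congrArg (fun q => q.coeff 1) h1
    simp [of_apply, ht1, hwne, htw] at h2
  · rintro ⟨X, Y, Z, h⟩
    have h0 := hthree (1 - of R _ t) htθ ⟨algebraMap R _ X, algebraMap R _ Y, algebraMap R _ Z, by
      rw [← map_pow, ← map_pow, ← map_pow, ← map_add, ← map_add, ← map_one (algebraMap R _),
        ← map_add, h, map_zero, zero_mul]⟩
    exact ht1 (of_injective (R := R) (by rw [map_one]; exact (sub_eq_zero.1 h0).symm))
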